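/- For each $n\ge 1$ let $(g_{ij})_{1\le i<j\le n}$ be i.i.d. standard Gaussian random variables, and for $\sigma\in\{-1,1\}^n$ let \[ H_n(\sigma) := \frac{1}{\sqrt n}\sum_{1\le i<j\le n} g_{ij}\,\sigma_i\sigma_j \] be the Hamiltonian of the Sherrington--Kirkpatrick model at zero external field. For $\beta>0$ let \[ F_n(\beta) := \log\sum_{\sigma\in\{-1,1\}^n} e^{\beta H_n(\sigma)} \] be its free energy at inverse temperature $\beta$. Then, for every fixed $\beta>0$, $F_n(\beta)$ has fluctuations of order at least $1$; that is, there are constants $c_1,c_2>0$ (which may depend on $\beta$) such that for all sufficiently large $n$ and all real numbers $a\le b$ with $b-a\le c_1$, \[ \mathbb{P}\bigl(a\le F_n(\beta)\le b\bigr)\le 1-c_2 . \] -/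

import Mathlib

open MeasureTheory ProbabilityTheory Filter

/-- The real random variables `X n`, each on its own probability space `(Ω n, μ n)`, have
fluctuations of order at least `δ n`: there are positive constants `c₁`, `c₂` such that for all
large `n` and all `a ≤ b` with `b - a ≤ c₁ δ n`, one has `ℙ(a ≤ X n ≤ b) ≤ 1 - c₂`. -/
def HasFluctuationsOfOrderAtLeast {Ω : ℕ → Type*} [∀ n, MeasurableSpace (Ω n)]
    (μ : ∀ n, Measure (Ω n)) (X : ∀ n, Ω n → ℝ) (δ : ℕ → ℝ) : Prop :=
  ∃ c₁ c₂ : ℝ, 0 < c₁ ∧ 0 < c₂ ∧ ∀ᶠ n in atTop, ∀ a b : ℝ, a ≤ b → b - a ≤ c₁ * δ n →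
    (μ n).real {ω | a ≤ X n ω ∧ X n ω ≤ b} ≤ 1 - c₂

namespace SKModel

/-- The index set of the couplings: pairs `i < j` of sites. -/
abbrev SitePair (n : ℕ) : Type := {p : Fin n × Fin n // p.1 < p.2}

/-- Spin configurations, i.e. elements of `{-1, 1}ⁿ`; the units of `ℤ` are exactly `1` and `-1`. -/
abbrev SpinConfig (n : ℕ) : Type := Fin n → ℤˣ

/-- The value of a spin as a real number, `1` or `-1`. -/
def spin {n : ℕ} (σ : SpinConfig n) (i : Fin n) : ℝ := ((σ i : ℤ) : ℝ)

/-- The Hamiltonian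
`H_n(σ) = n^{-1/2} ∑_{i < j} g_{ij} σ_i σ_j + h ∑_i σ_i` for given couplings `g`. -/
noncomputable def hamiltonian (n : ℕ) (h : ℝ) (g : SitePair n → ℝ) (σ : SpinConfig n) : ℝ :=
  1 / √(n : ℝ) * ∑ p : SitePair n, g p * spin σ p.1.1 * spin σ p.1.2 + h * ∑ i, spin σ i

/-- The free energy `F_n(β, h) = log ∑_σ exp(β H_n(σ))` for given couplings `g`. -/
noncomputable def freeEnergy (n : ℕ) (β h : ℝ) (g : SitePair n → ℝ) : ℝ :=
  Real.log (∑ σ : SpinConfig n, Real.exp (β * hamiltonian n h g σ))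

end SKModel

/-!
The free energy is compared with its value after the couplings are dilated by a factor `s > 1`
close to `1`.

With `s = √(1 + ε / n)`, the dilation is statistically almost invisible: there are about `n² / 2`
couplings, and the `χ²`-distance between the standard Gaussian measure in dimension `N` and its
dilation by `√(1 + u)` is at most `exp (u² N) - 1`, which is of order `ε²` for `u = ε / n`
(`measureReal_sub_dilation_le`).

On the other hand, dilating the couplings amounts to changing the inverse temperature from `β` to
`s β`, and `(F_n(β) - n log 2) / β` is nondecreasing in `β` because power means are monotone
(`SKModel.mul_freeEnergy_sub_le`). Hence the free energy increases by at least
`(s - 1) (F_n(β) - n log 2)`, which is of constant order as soon as `F_n(β) - n log 2` is of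
order `n`. By the same monotonicity it is enough to have this at some inverse temperature
`b ≤ β` with `b < 1`. There the partition function has a second moment comparable to the square of
its mean `2ⁿ exp (b² (n - 1) / 4)` (`SKModel.integral_partitionFunction_sq_le`, where the overlap
of two replicas is handled by a Hubbard–Stratonovich transformation), so it exceeds half of that
mean with probability at least `√(1 - b²) / 4`, by the Paley–Zygmund inequality.

A variable that moves by more than `c` with probability at least `p`, while its law changes by at
most `d < p` in total variation, cannot put mass more than `1 - (p - d) / 2` on an interval of
length `c` (`measureReal_mem_Icc_le_of_shift`).
-/

/-! ### Gaussian integrals -/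

theorem integral_exp_mul_sq_gaussianReal {a : ℝ} (ha : a < 1 / 2) :
    ∫ x, Real.exp (a * x ^ 2) ∂gaussianReal 0 1 = (√(1 - 2 * a))⁻¹ := by
  have hpdf : ∀ x : ℝ, gaussianPDFReal 0 1 x • Real.exp (a * x ^ 2)
      = (√(2 * Real.pi))⁻¹ * Real.exp (-(1 / 2 - a) * x ^ 2) := by
    intro x
    rw [gaussianPDFReal, smul_eq_mul, mul_assoc, ← Real.exp_add]
    simp only [NNReal.coe_one, mul_one, sub_zero]
    congr 2
    ring
  have hb : 0 < 1 / 2 - a := by linarith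
  rw [integral_gaussianReal_eq_integral_smul one_ne_zero]
  simp_rw [hpdf]
  rw [integral_const_mul, integral_gaussian, ← Real.sqrt_inv, ← Real.sqrt_inv,
    ← Real.sqrt_mul (by positivity)]
  congr 1
  have := Real.pi_pos
  have : 1 - 2 * a ≠ 0 := by linarith
  field_simp

theorem integrable_exp_mul_sq_gaussianReal {a : ℝ} (ha : a < 1 / 2) :
    Integrable (fun x => Real.exp (a * x ^ 2)) (gaussianReal 0 1) := by
  -- a non-integrable function would have integral `0`
  apply Integrable.of_integral_ne_zero
  rw [integral_exp_mul_sq_gaussianReal ha]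
  have : 0 < √(1 - 2 * a) := Real.sqrt_pos.2 (by linarith)
  positivity

theorem integral_exp_linear_pi_gaussianReal {ι : Type*} [Fintype ι] (a : ι → ℝ) :
    ∫ x, Real.exp (∑ i, a i * x i) ∂Measure.pi (fun _ : ι => gaussianReal 0 1)
      = Real.exp (∑ i, a i ^ 2 / 2) := by
  simp_rw [Real.exp_sum]
  rw [integral_fintype_prod_eq_prod (fun i x => Real.exp (a i * x))]
  refine Finset.prod_congr rfl fun i _ => ?_
  have := congrFun (mgf_id_gaussianReal (μ := 0) (v := 1)) (a i)
  simpa [mgf] using this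

theorem integrable_exp_linear_pi_gaussianReal {ι : Type*} [Fintype ι] (a : ι → ℝ) :
    Integrable (fun x => Real.exp (∑ i, a i * x i))
      (Measure.pi (fun _ : ι => gaussianReal 0 1)) := by
  simp_rw [Real.exp_sum]
  exact Integrable.fintype_prod (f := fun i x => Real.exp (a i * x))
    fun i => integrable_exp_mul_gaussianReal (a i)

/-! ### Dilations of the standard Gaussian measure -/

theorem pi_withDensity_ofReal {ι : Type*} [Fintype ι] {α : Type*} [MeasurableSpace α]
    (μ : Measure α) [IsProbabilityMeasure μ] {f : α → ℝ} (hf0 : ∀ x, 0 ≤ f x)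
    (hf : Integrable f μ) :
    Measure.pi (fun _ : ι => μ.withDensity fun x => ENNReal.ofReal (f x))
      = (Measure.pi fun _ : ι => μ).withDensity fun x => ENNReal.ofReal (∏ i, f (x i)) := by
  have : IsFiniteMeasure (μ.withDensity fun x => ENNReal.ofReal (f x)) :=
    isFiniteMeasure_withDensity_ofReal hf.2
  refine (Measure.pi_eq fun s hs => ?_)
  have hs' : MeasurableSet (Set.univ.pi s) := MeasurableSet.univ_pi hs
  have hind : ∀ x : ι → α, (Set.univ.pi s).indicator (fun x => ∏ i, f (x i)) x
      = ∏ i, (s i).indicator f (x i) := by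
    intro x
    classical
    by_cases hx : x ∈ Set.univ.pi s
    · rw [Set.indicator_of_mem hx]
      exact Finset.prod_congr rfl fun i _ => (Set.indicator_of_mem (hx i trivial) f).symm
    · rw [Set.indicator_of_notMem hx]
      simp only [Set.mem_pi, Set.mem_univ, true_imp_iff, not_forall] at hx
      obtain ⟨i, hi⟩ := hx
      exact (Finset.prod_eq_zero (Finset.mem_univ i) (Set.indicator_of_notMem hi f)).symm
  rw [withDensity_apply _ hs', ← ofReal_integral_eq_lintegral_ofReal
      (Integrable.fintype_prod fun _ => hf).integrableOn
      (ae_of_all _ fun x => Finset.prod_nonneg fun i _ => hf0 _),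
    ← integral_indicator hs']
  simp_rw [hind]
  rw [integral_fintype_prod_eq_prod (fun i => (s i).indicator f), ENNReal.ofReal_prod_of_nonneg
    fun i _ => integral_nonneg fun x => Set.indicator_nonneg (fun x _ => hf0 x) x]
  refine Finset.prod_congr rfl fun i _ => ?_
  rw [withDensity_apply _ (hs i), integral_indicator (hs i),
    ofReal_integral_eq_lintegral_ofReal hf.integrableOn (ae_of_all _ hf0)]

/-- The likelihood ratio of `N(0, 1 + u)` with respect to `N(0, 1)`. -/
noncomputable def gaussianDilationDensity (u x : ℝ) : ℝ :=
  (√(1 + u))⁻¹ * Real.exp (u / (2 * (1 + u)) * x ^ 2)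

theorem gaussianDilationDensity_nonneg (u x : ℝ) : 0 ≤ gaussianDilationDensity u x := by
  unfold gaussianDilationDensity; positivity

theorem integrable_gaussianDilationDensity {u : ℝ} (hu : 0 ≤ u) :
    Integrable (gaussianDilationDensity u) (gaussianReal 0 1) := by
  refine (integrable_exp_mul_sq_gaussianReal ?_).const_mul _
  rw [div_lt_div_iff₀ (by linarith) two_pos]
  linarith

theorem map_sqrt_mul_gaussianReal {u : ℝ} (hu : 0 ≤ u) :
    (gaussianReal 0 1).map (fun x => √(1 + u) * x)
      = (gaussianReal 0 1).withDensity fun x => ENNReal.ofReal (gaussianDilationDensity u x) := by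
  have h1 : (0 : ℝ) < 1 + u := by linarith
  have hv : NNReal.mk (√(1 + u) ^ 2) (sq_nonneg _) * 1 ≠ 0 := by
    rw [mul_one, ← NNReal.coe_ne_zero]
    simp only [NNReal.coe_mk]
    positivity
  rw [gaussianReal_map_const_mul, mul_zero, gaussianReal_of_var_ne_zero _ hv,
    gaussianReal_of_var_ne_zero _ one_ne_zero,
    ← withDensity_mul _ (measurable_gaussianPDF 0 1)
      (by unfold gaussianDilationDensity; fun_prop)]
  congr 1
  ext x
  rw [Pi.mul_apply, gaussianPDF, gaussianPDF, ← ENNReal.ofReal_mul (gaussianPDFReal_nonneg _ _ _)]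
  congr 1
  simp only [gaussianPDFReal, gaussianDilationDensity, NNReal.coe_one, mul_one, sub_zero,
    NNReal.coe_mk, Real.sq_sqrt h1.le]
  rw [Real.sqrt_mul (by positivity), mul_inv, mul_mul_mul_comm, ← Real.exp_add]
  congr 2
  field_simp
  ring

theorem inv_sqrt_one_sub_le_exp {x : ℝ} (h0 : 0 ≤ x) (h1 : x ≤ 1 / 2) :
    (√(1 - x))⁻¹ ≤ Real.exp x := by
  rw [inv_le_comm₀ (Real.sqrt_pos.2 (by linarith)) (Real.exp_pos _), ← Real.exp_neg]
  apply Real.le_sqrt_of_sq_le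
  rw [← Real.exp_nat_mul, show ((2 : ℕ) : ℝ) * -x = -(2 * x) by push_cast; ring, Real.exp_neg]
  calc (Real.exp (2 * x))⁻¹ ≤ (2 * x + 1)⁻¹ :=
        inv_anti₀ (by linarith) (Real.add_one_le_exp _)
    _ ≤ 1 - x := by
        rw [inv_le_iff_one_le_mul₀ (by linarith)]
        nlinarith

theorem gaussianDilationDensity_sq {u : ℝ} (hu : 0 ≤ u) (x : ℝ) :
    gaussianDilationDensity u x ^ 2 = (1 + u)⁻¹ * Real.exp (u / (1 + u) * x ^ 2) := by
  rw [gaussianDilationDensity, mul_pow, inv_pow, Real.sq_sqrt (by linarith), ← Real.exp_nat_mul]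
  congr 2
  have : 1 + u ≠ 0 := by linarith
  push_cast
  field_simp

theorem integrable_gaussianDilationDensity_sq {u : ℝ} (hu : 0 ≤ u) (hu1 : u < 1) :
    Integrable (fun x => gaussianDilationDensity u x ^ 2) (gaussianReal 0 1) := by
  simp_rw [gaussianDilationDensity_sq hu]
  refine (integrable_exp_mul_sq_gaussianReal ?_).const_mul _
  rw [div_lt_div_iff₀ (by linarith) two_pos]
  linarith

theorem integral_gaussianDilationDensity_sq_le {u : ℝ} (hu : 0 ≤ u) (hu2 : u ^ 2 ≤ 1 / 2) :
    ∫ x, gaussianDilationDensity u x ^ 2 ∂gaussianReal 0 1 ≤ Real.exp (u ^ 2) := by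
  have hu1 : u < 1 := by nlinarith
  have h1 : 0 < 1 + u := by linarith
  refine le_trans (le_of_eq ?_) (inv_sqrt_one_sub_le_exp (sq_nonneg u) hu2)
  simp_rw [gaussianDilationDensity_sq hu]
  rw [integral_const_mul, integral_exp_mul_sq_gaussianReal (by
    rw [div_lt_div_iff₀ (by linarith) two_pos]; linarith)]
  rw [show 1 - u ^ 2 = (1 + u) ^ 2 * (1 - 2 * (u / (1 + u))) by field_simp; ring,
    Real.sqrt_mul (by positivity), Real.sqrt_sq h1.le, mul_inv]

/-- The `χ²`-bound on the total variation distance between the standard Gaussian measure and its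
dilation by `√(1 + u)`. The parameter `t` comes from the inequality
`|y| ≤ t / 2 + y² / (2 t)`, used in place of the Cauchy–Schwarz inequality. -/
theorem measureReal_sub_dilation_le {ι : Type*} [Fintype ι] {u : ℝ} (hu : 0 ≤ u)
    (hu2 : u ^ 2 ≤ 1 / 2) {t : ℝ} (ht : 0 < t) {A : Set (ι → ℝ)} (hA : MeasurableSet A) :
    (Measure.pi fun _ : ι => gaussianReal 0 1).real A
      ≤ (Measure.pi fun _ : ι => gaussianReal 0 1).real {x | (fun i => √(1 + u) * x i) ∈ A}
        + (t / 2 + (Real.exp (u ^ 2 * Fintype.card ι) - 1) / (2 * t)) := by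
  have hu1 : u < 1 := by nlinarith
  set P := Measure.pi fun _ : ι => gaussianReal 0 1 with hP
  set L : (ι → ℝ) → ℝ := fun x => ∏ i, gaussianDilationDensity u (x i) with hL
  have hLi : Integrable L P :=
    Integrable.fintype_prod fun _ => integrable_gaussianDilationDensity hu
  have hL0 : ∀ x, 0 ≤ L x := fun x =>
    Finset.prod_nonneg fun i _ => gaussianDilationDensity_nonneg _ _
  have hL2 : ∀ x, L x ^ 2 = ∏ i, gaussianDilationDensity u (x i) ^ 2 := fun x =>
    (Finset.prod_pow _ _ _).symm
  have hL2i : Integrable (fun x => L x ^ 2) P := by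
    simp_rw [hL2]
    exact Integrable.fintype_prod (f := fun _ y => gaussianDilationDensity u y ^ 2)
      fun _ => integrable_gaussianDilationDensity_sq hu hu1
  have hmap : P.map (fun x i => √(1 + u) * x i) = P.withDensity fun x => ENNReal.ofReal (L x) := by
    have := Measure.pi_map_pi (μ := fun _ : ι => gaussianReal 0 1)
      (f := fun _ x => √(1 + u) * x) (fun i => by fun_prop)
    rw [hP, this, map_sqrt_mul_gaussianReal hu]
    exact pi_withDensity_ofReal _ (gaussianDilationDensity_nonneg u)
      (integrable_gaussianDilationDensity hu)
  have hmeas : Measurable fun (x : ι → ℝ) i => √(1 + u) * x i := by fun_prop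
  have hQ : ∀ B, MeasurableSet B →
      P.real {x | (fun i => √(1 + u) * x i) ∈ B} = ∫ x in B, L x ∂P := by
    intro B hB
    rw [integral_eq_lintegral_of_nonneg_ae (ae_of_all _ hL0) hLi.1.restrict,
      ← withDensity_apply _ hB, ← hmap, Measure.map_apply hmeas hB]
    rfl
  have hL1 : ∫ x, L x ∂P = 1 := by
    have := hQ Set.univ MeasurableSet.univ
    simpa using this.symm
  have hLsq : ∫ x, L x ^ 2 ∂P ≤ Real.exp (u ^ 2 * Fintype.card ι) := by
    simp_rw [hL2]
    rw [hP, integral_fintype_prod_eq_pow (fun y => gaussianDilationDensity u y ^ 2), mul_comm,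
      Real.exp_nat_mul]
    exact pow_le_pow_left₀ (integral_nonneg fun x => sq_nonneg _)
      (integral_gaussianDilationDensity_sq_le hu hu2) _
  have hbound : ∀ x, 1 - L x ≤ t / 2 + (1 - 2 * L x + L x ^ 2) / (2 * t) := by
    intro x
    have : t / 2 + (1 - 2 * L x + L x ^ 2) / (2 * t) - (1 - L x)
        = (t - (1 - L x)) ^ 2 / (2 * t) := by field_simp; ring
    have : 0 ≤ (t - (1 - L x)) ^ 2 / (2 * t) := by positivity
    linarith
  have h1 : Integrable (fun x => 1 - 2 * L x) P := (integrable_const _).sub (hLi.const_mul 2)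
  have h2 : Integrable (fun x => (1 - 2 * L x + L x ^ 2) / (2 * t)) P := (h1.add hL2i).div_const _
  have hRi : Integrable (fun x => t / 2 + (1 - 2 * L x + L x ^ 2) / (2 * t)) P :=
    (integrable_const _).add h2
  rw [hQ A hA, ← sub_le_iff_le_add']
  calc P.real A - ∫ x in A, L x ∂P = ∫ x in A, (1 - L x) ∂P := by
        rw [integral_sub (integrable_const _) hLi.integrableOn]; simp
    _ ≤ ∫ x in A, (t / 2 + (1 - 2 * L x + L x ^ 2) / (2 * t)) ∂P :=
        integral_mono ((integrable_const _).sub hLi.integrableOn) hRi.integrableOn hbound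
    _ ≤ ∫ x, (t / 2 + (1 - 2 * L x + L x ^ 2) / (2 * t)) ∂P := by
        refine setIntegral_le_integral hRi (ae_of_all _ fun x => ?_)
        have : 0 ≤ (1 - L x) ^ 2 := sq_nonneg _
        have h' : 0 ≤ 1 - 2 * L x + L x ^ 2 := by linarith
        simp only [Pi.zero_apply]
        positivity
    _ = t / 2 + (∫ x, L x ^ 2 ∂P - 1) / (2 * t) := by
        rw [integral_add (integrable_const _) h2, integral_div, integral_div, integral_add h1 hL2i,
          integral_sub (integrable_const _) (hLi.const_mul 2), integral_const_mul, hL1]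
        simp only [integral_const, probReal_univ, smul_eq_mul, one_mul]
        ring
    _ ≤ _ := by gcongr

/-! ### Moments of the partition function -/

/-- A form of the Paley–Zygmund inequality. -/
theorem inv_four_mul_le_measureReal_half_le {α : Type*} [MeasurableSpace α] {P : Measure α}
    [IsProbabilityMeasure P] {W : α → ℝ} {m K : ℝ} (hW : Measurable W) (hWi : Integrable W P)
    (hW2 : Integrable (fun x => W x ^ 2) P) (hm : 0 < m) (hK : 0 < K)
    (hmean : ∫ x, W x ∂P = m) (hsq : ∫ x, W x ^ 2 ∂P ≤ K * m ^ 2) :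
    1 / (4 * K) ≤ P.real {x | m / 2 ≤ W x} := by
  set A : Set α := {x | m / 2 ≤ W x}
  have hA : MeasurableSet A := measurableSet_le measurable_const hW
  -- off `A` one has `W ≤ m / 2`; on `A`, the bound is the inequality of the arithmetic and
  -- geometric means for `W ^ 2 / (4 K m)` and `K m`
  have hpt : ∀ x, W x ≤ m / 2 + W x ^ 2 / (4 * K * m) + A.indicator (fun _ => K * m) x := by
    intro x
    by_cases hx : x ∈ A
    · rw [Set.indicator_of_mem hx]
      have : W x ^ 2 / (4 * K * m) + K * m - W x = (W x - 2 * K * m) ^ 2 / (4 * K * m) := by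
        field_simp; ring
      have : 0 ≤ (W x - 2 * K * m) ^ 2 / (4 * K * m) := by positivity
      linarith
    · rw [Set.indicator_of_notMem hx]
      have : W x < m / 2 := not_le.1 hx
      have : 0 ≤ W x ^ 2 / (4 * K * m) := by positivity
      linarith
  have i1 : Integrable (fun x => m / 2 + W x ^ 2 / (4 * K * m)) P :=
    (integrable_const _).add (hW2.div_const _)
  have i2 : Integrable (A.indicator fun _ => K * m) P := (integrable_const _).indicator hA
  have hint := integral_mono hWi (i1.add i2) hpt
  rw [integral_add' i1 i2, integral_add (integrable_const _) (hW2.div_const _), integral_div,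
    integral_div, hmean, integral_indicator hA] at hint
  simp only [integral_const, probReal_univ, smul_eq_mul, one_mul, measureReal_restrict_apply_univ]
    at hint
  have h3 : (∫ x, W x ^ 2 ∂P) / (4 * K * m) ≤ m / 4 := by
    rw [div_le_div_iff₀ (by positivity) (by norm_num)]
    linarith
  rw [div_le_iff₀ (by positivity)]
  have : m * 1 ≤ m * (P.real A * (4 * K)) := by nlinarith
  exact le_of_mul_le_mul_left this hm

namespace SKModel

variable {n : ℕ}

theorem spin_sq (σ : SpinConfig n) (i : Fin n) : spin σ i ^ 2 = 1 := by
  unfold spin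
  rcases Int.units_eq_one_or (σ i) with h | h <;> simp [h]

theorem spin_mul (σ τ : SpinConfig n) (i : Fin n) : spin (σ * τ) i = spin σ i * spin τ i := by
  simp [spin]

theorem card_spinConfig : Fintype.card (SpinConfig n) = 2 ^ n := by
  simp

theorem two_mul_sum_sitePair (f : Fin n → ℝ) :
    2 * ∑ p : SitePair n, f p.1.1 * f p.1.2 = (∑ i, f i) ^ 2 - ∑ i, f i ^ 2 := by
  have h1 : ∑ p : SitePair n, f p.1.1 * f p.1.2
      = ∑ i, ∑ j, if i < j then f i * f j else 0 := by
    rw [← Fintype.sum_prod_type' (f := fun i j => if i < j then f i * f j else 0),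
      ← Finset.sum_filter]
    exact (Finset.sum_subtype _ (by simp) fun p : Fin n × Fin n => f p.1 * f p.2).symm
  have h2 : ∑ p : SitePair n, f p.1.1 * f p.1.2
      = ∑ i, ∑ j, if j < i then f i * f j else 0 := by
    rw [h1, Finset.sum_comm]
    simp_rw [mul_comm]
  have h3 : ∑ i, f i ^ 2 = ∑ i, ∑ j, if i = j then f i * f j else 0 := by
    simp [sq]
  rw [two_mul]
  nth_rewrite 1 [h1]
  rw [h2, h3, sq, Finset.sum_mul_sum, eq_sub_iff_add_eq]
  simp_rw [← Finset.sum_add_distrib]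
  refine Finset.sum_congr rfl fun i _ => Finset.sum_congr rfl fun j _ => ?_
  rcases lt_trichotomy i j with h | h | h
  · simp [h, h.not_gt, h.ne]
  · simp [h]
  · simp [h, h.not_gt, h.ne']

theorem two_mul_sum_sitePair_spin (σ : SpinConfig n) :
    2 * ∑ p : SitePair n, spin σ p.1.1 * spin σ p.1.2 = (∑ i, spin σ i) ^ 2 - n := by
  rw [two_mul_sum_sitePair]
  simp [spin_sq]

theorem two_mul_card_sitePair : 2 * (Fintype.card (SitePair n) : ℝ) = (n : ℝ) ^ 2 - n := by
  simpa using two_mul_sum_sitePair (n := n) fun _ => 1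

theorem mul_hamiltonian_zero_field (β : ℝ) (g : SitePair n → ℝ) (σ : SpinConfig n) :
    β * hamiltonian n 0 g σ = ∑ p, β / √n * (spin σ p.1.1 * spin σ p.1.2) * g p := by
  rw [hamiltonian, zero_mul, add_zero, ← mul_assoc, Finset.mul_sum]
  exact Finset.sum_congr rfl fun p _ => by ring

/-- The standard Gaussian measure on the couplings. -/
noncomputable abbrev couplingLaw (n : ℕ) : Measure (SitePair n → ℝ) :=
  Measure.pi fun _ => gaussianReal 0 1

/-- The partition function at zero external field. -/
noncomputable def partitionFunction (n : ℕ) (β : ℝ) (g : SitePair n → ℝ) : ℝ :=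
  ∑ σ : SpinConfig n, Real.exp (β * hamiltonian n 0 g σ)

theorem partitionFunction_pos (β : ℝ) (g : SitePair n → ℝ) : 0 < partitionFunction n β g :=
  Finset.sum_pos (fun _ _ => Real.exp_pos _) Finset.univ_nonempty

@[fun_prop]
theorem measurable_partitionFunction (β : ℝ) : Measurable (partitionFunction n β) := by
  unfold partitionFunction hamiltonian
  fun_prop

theorem integrable_exp_hamiltonian (β : ℝ) (σ : SpinConfig n) :
    Integrable (fun g => Real.exp (β * hamiltonian n 0 g σ)) (couplingLaw n) := by
  simp_rw [mul_hamiltonian_zero_field]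
  exact integrable_exp_linear_pi_gaussianReal _

theorem integrable_exp_hamiltonian_add (β : ℝ) (σ τ : SpinConfig n) :
    Integrable (fun g => Real.exp (β * hamiltonian n 0 g σ + β * hamiltonian n 0 g τ))
      (couplingLaw n) := by
  simp_rw [mul_hamiltonian_zero_field, ← Finset.sum_add_distrib, ← add_mul]
  exact integrable_exp_linear_pi_gaussianReal _

theorem integral_exp_hamiltonian (β : ℝ) (σ : SpinConfig n) :
    ∫ g, Real.exp (β * hamiltonian n 0 g σ) ∂couplingLaw n
      = Real.exp (β ^ 2 * Fintype.card (SitePair n) / (2 * n)) := by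
  simp_rw [mul_hamiltonian_zero_field]
  rw [integral_exp_linear_pi_gaussianReal]
  have : ∀ p : SitePair n, (β / √n * (spin σ p.1.1 * spin σ p.1.2)) ^ 2 / 2 = β ^ 2 / (2 * n) := by
    intro p
    rw [mul_pow, mul_pow, spin_sq, spin_sq, div_pow, Real.sq_sqrt n.cast_nonneg]
    ring
  simp_rw [this]
  simp
  ring

/-- The correlation of two Boltzmann weights is governed by the overlap `∑ i, σ i τ i`. -/
theorem integral_exp_hamiltonian_add_le (β : ℝ) (σ τ : SpinConfig n) :
    ∫ g, Real.exp (β * hamiltonian n 0 g σ + β * hamiltonian n 0 g τ) ∂couplingLaw n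
      ≤ Real.exp (β ^ 2 * Fintype.card (SitePair n) / (2 * n)) ^ 2
        * Real.exp ((β / √n) ^ 2 * (∑ i, spin (σ * τ) i) ^ 2 / 2) := by
  simp_rw [mul_hamiltonian_zero_field, ← Finset.sum_add_distrib, ← add_mul]
  rw [integral_exp_linear_pi_gaussianReal, ← Real.exp_nat_mul, ← Real.exp_add, Real.exp_le_exp]
  have h : ∀ p : SitePair n, (β / √n * (spin σ p.1.1 * spin σ p.1.2)
      + β / √n * (spin τ p.1.1 * spin τ p.1.2)) ^ 2 / 2
      = β ^ 2 / n + β ^ 2 / n * (spin (σ * τ) p.1.1 * spin (σ * τ) p.1.2) := by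
    intro p
    simp only [spin_mul]
    have e : ∀ x y x' y' : ℝ, x ^ 2 = 1 → y ^ 2 = 1 → x' ^ 2 = 1 → y' ^ 2 = 1 →
        (β / √n * (x * y) + β / √n * (x' * y')) ^ 2 / 2
          = (β / √n) ^ 2 + (β / √n) ^ 2 * (x * x' * (y * y')) := by
      intro x y x' y' hx hy hx' hy'
      have : (β / √n * (x * y) + β / √n * (x' * y')) ^ 2 / 2
          = (β / √n) ^ 2 * ((x ^ 2 * y ^ 2 + x' ^ 2 * y' ^ 2) / 2 + x * x' * (y * y')) := by ring
      rw [this, hx, hy, hx', hy']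
      ring
    rw [e _ _ _ _ (spin_sq _ _) (spin_sq _ _) (spin_sq _ _) (spin_sq _ _), div_pow,
      Real.sq_sqrt n.cast_nonneg]
  simp_rw [h]
  rw [Finset.sum_add_distrib, ← Finset.mul_sum, div_pow, Real.sq_sqrt n.cast_nonneg]
  have h2 := two_mul_sum_sitePair_spin (σ * τ)
  have h3 : ∑ p : SitePair n, spin (σ * τ) p.1.1 * spin (σ * τ) p.1.2
      ≤ (∑ i, spin (σ * τ) i) ^ 2 / 2 := by
    have : (0 : ℝ) ≤ n := n.cast_nonneg
    linarith
  have h4 := mul_le_mul_of_nonneg_left h3 (show 0 ≤ β ^ 2 / n by positivity)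
  have h5 : ∑ _p : SitePair n, β ^ 2 / n
      = ((2 : ℕ) : ℝ) * (β ^ 2 * Fintype.card (SitePair n) / (2 * n)) := by
    simp
    ring
  rw [h5]
  linarith

theorem sum_exp_mul_sum_spin (z : ℝ) :
    ∑ σ : SpinConfig n, Real.exp (z * ∑ i, spin σ i) = (2 * Real.cosh z) ^ n := by
  simp_rw [Finset.mul_sum, Real.exp_sum, spin]
  have := Finset.prod_univ_sum (ι := Fin n) (t := fun _ => (Finset.univ : Finset ℤˣ))
    (f := fun _ u => Real.exp (z * ((u : ℤ) : ℝ)))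
  rw [Fintype.piFinset_univ] at this
  rw [← this, Finset.prod_const, Finset.card_univ, Fintype.card_fin]
  congr 1
  rw [Real.cosh_eq]
  simp [UnitsInt.univ]
  ring

/-- Exponential moment of the squared magnetisation of independent uniform spins. The square in
the exponent is linearised by an auxiliary Gaussian variable (Hubbard–Stratonovich). -/
theorem sum_exp_sq_sum_spin_le (c : ℝ) (hc : n * c ^ 2 < 1) :
    ∑ σ : SpinConfig n, Real.exp (c ^ 2 * (∑ i, spin σ i) ^ 2 / 2)
      ≤ 2 ^ n * (√(1 - n * c ^ 2))⁻¹ := by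
  have hs : ∀ s : ℝ, Real.exp (c ^ 2 * s ^ 2 / 2)
      = ∫ z, Real.exp (c * z * s) ∂gaussianReal 0 1 := by
    intro s
    have := congrFun (mgf_id_gaussianReal (μ := 0) (v := 1)) (c * s)
    simp only [mgf, id] at this
    simp_rw [show ∀ z, c * z * s = c * s * z from fun z => by ring]
    rw [this]
    simp [mul_pow]
  have hi : ∀ s : ℝ, Integrable (fun z => Real.exp (c * z * s)) (gaussianReal 0 1) := by
    intro s
    simp_rw [show ∀ z, c * z * s = c * s * z from fun z => by ring]
    exact integrable_exp_mul_gaussianReal _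
  simp_rw [hs]
  rw [← integral_finsetSum _ fun σ _ => hi _]
  have ha : n * c ^ 2 / 2 < 1 / 2 := by linarith
  have hb := integral_exp_mul_sq_gaussianReal ha
  rw [show 2 * (n * c ^ 2 / 2) = n * c ^ 2 by ring] at hb
  rw [← hb, ← integral_const_mul]
  refine integral_mono (integrable_finsetSum _ fun σ _ => hi _)
    ((integrable_exp_mul_sq_gaussianReal ha).const_mul _) fun z => ?_
  simp only
  rw [sum_exp_mul_sum_spin, mul_pow]
  gcongr
  calc Real.cosh (c * z) ^ n ≤ Real.exp ((c * z) ^ 2 / 2) ^ n :=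
        pow_le_pow_left₀ (Real.cosh_pos _).le (Real.cosh_le_exp_half_sq _) _
    _ = Real.exp (n * c ^ 2 / 2 * z ^ 2) := by
        rw [← Real.exp_nat_mul]
        ring_nf

theorem integral_partitionFunction (β : ℝ) :
    ∫ g, partitionFunction n β g ∂couplingLaw n
      = 2 ^ n * Real.exp (β ^ 2 * Fintype.card (SitePair n) / (2 * n)) := by
  unfold partitionFunction
  rw [integral_finsetSum _ fun σ _ => integrable_exp_hamiltonian β σ]
  simp_rw [integral_exp_hamiltonian]
  rw [Finset.sum_const, Finset.card_univ, card_spinConfig]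
  simp

theorem partitionFunction_sq (β : ℝ) (g : SitePair n → ℝ) :
    partitionFunction n β g ^ 2
      = ∑ σ, ∑ τ, Real.exp (β * hamiltonian n 0 g σ + β * hamiltonian n 0 g τ) := by
  simp_rw [partitionFunction, sq, Finset.sum_mul_sum, Real.exp_add]

theorem integrable_partitionFunction_sq (β : ℝ) :
    Integrable (fun g => partitionFunction n β g ^ 2) (couplingLaw n) := by
  simp_rw [partitionFunction_sq]
  exact integrable_finsetSum _ fun σ _ => integrable_finsetSum _ fun τ _ =>
    integrable_exp_hamiltonian_add β σ τ

/-- In the high-temperature regime `β < 1`, the second moment of the partition function is at most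
a constant times the square of the first moment. -/
theorem integral_partitionFunction_sq_le {β : ℝ} (hn : n ≠ 0) (hβ : β ^ 2 < 1) :
    ∫ g, partitionFunction n β g ^ 2 ∂couplingLaw n
      ≤ (√(1 - β ^ 2))⁻¹
        * (2 ^ n * Real.exp (β ^ 2 * Fintype.card (SitePair n) / (2 * n))) ^ 2 := by
  simp_rw [partitionFunction_sq]
  rw [integral_finsetSum _ fun σ _ => integrable_finsetSum _ fun τ _ =>
    integrable_exp_hamiltonian_add β σ τ]
  set E := Real.exp (β ^ 2 * Fintype.card (SitePair n) / (2 * n))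
  have hc : n * (β / √n) ^ 2 = β ^ 2 := by
    have : (n : ℝ) ≠ 0 := Nat.cast_ne_zero.2 hn
    rw [div_pow, Real.sq_sqrt n.cast_nonneg]
    field_simp
  calc _ ≤ ∑ _σ : SpinConfig n, E ^ 2 * (2 ^ n * (√(1 - β ^ 2))⁻¹) := by
        refine Finset.sum_le_sum fun σ _ => ?_
        rw [integral_finsetSum _ fun τ _ => integrable_exp_hamiltonian_add β σ τ]
        refine (Finset.sum_le_sum fun τ _ => integral_exp_hamiltonian_add_le β σ τ).trans ?_
        rw [← Finset.mul_sum]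
        gcongr
        -- the overlap `σ τ` runs over all configurations as `τ` does
        have hperm := Equiv.sum_comp (Equiv.mulLeft σ)
          fun ρ : SpinConfig n => Real.exp ((β / √n) ^ 2 * (∑ i, spin ρ i) ^ 2 / 2)
        simp only [Equiv.coe_mulLeft] at hperm
        rw [hperm]
        have := sum_exp_sq_sum_spin_le (n := n) (β / √n) (by rwa [hc])
        rwa [hc] at this
    _ = _ := by
        rw [Finset.sum_const, Finset.card_univ, card_spinConfig]
        simp
        ring

/-- At high temperature, the partition function is at least half of its mean with probability
bounded away from `0` uniformly in `n`. -/
theorem le_measureReal_partitionFunction {β : ℝ} (hn : n ≠ 0) (hβ : β ^ 2 < 1) :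
    √(1 - β ^ 2) / 4 ≤ (couplingLaw n).real
      {g | 2 ^ n * Real.exp (β ^ 2 * Fintype.card (SitePair n) / (2 * n)) / 2
        ≤ partitionFunction n β g} := by
  have h0 : 0 < √(1 - β ^ 2) := Real.sqrt_pos.2 (by linarith)
  have := inv_four_mul_le_measureReal_half_le (P := couplingLaw n)
    (measurable_partitionFunction β)
    (integrable_finsetSum _ fun σ _ => integrable_exp_hamiltonian β σ)
    (integrable_partitionFunction_sq β) (by positivity) (inv_pos.2 h0)
    (integral_partitionFunction β) (integral_partitionFunction_sq_le hn hβ)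
  refine le_trans (le_of_eq ?_) this
  field_simp

/-! ### Dependence of the free energy on the inverse temperature -/

/-- Monotonicity of power means, for the uniform probability measure on spin configurations. -/
theorem partitionFunction_div_rpow_le {b r : ℝ} (hr : 1 ≤ r) (g : SitePair n → ℝ) :
    (partitionFunction n b g / 2 ^ n) ^ r ≤ partitionFunction n (r * b) g / 2 ^ n := by
  have h := Real.rpow_arith_mean_le_arith_mean_rpow (Finset.univ : Finset (SpinConfig n))
    (fun _ => (2 ^ n)⁻¹) (fun σ => Real.exp (b * hamiltonian n 0 g σ))
    (fun _ _ => by positivity)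
    (by rw [Finset.sum_const, Finset.card_univ, card_spinConfig]; simp)
    (fun _ _ => (Real.exp_pos _).le) hr
  simp_rw [← Finset.mul_sum, ← Real.exp_mul] at h
  simp only [partitionFunction, div_eq_inv_mul]
  refine h.trans (le_of_eq ?_)
  congr 1
  exact Finset.sum_congr rfl fun σ _ => by ring_nf

/-- The quotient `(F_n(b) - n log 2) / b` is nondecreasing in `b > 0`, written without division:
`n log 2` is the free energy at `b = 0`. -/
theorem mul_freeEnergy_sub_le {b r : ℝ} (hr : 1 ≤ r) (g : SitePair n → ℝ) :
    r * (freeEnergy n b 0 g - n * Real.log 2) ≤ freeEnergy n (r * b) 0 g - n * Real.log 2 := by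
  have hlog : ∀ b, freeEnergy n b 0 g - n * Real.log 2
      = Real.log (partitionFunction n b g / 2 ^ n) := fun b => by
    rw [Real.log_div (partitionFunction_pos b g).ne' (by positivity), Real.log_pow]
    rfl
  have hp := partitionFunction_pos b g
  rw [hlog, hlog, ← Real.log_rpow (by positivity)]
  exact Real.log_le_log (by positivity) (partitionFunction_div_rpow_le hr g)

theorem freeEnergy_smul (s β : ℝ) (g : SitePair n → ℝ) :
    freeEnergy n β 0 (fun p => s * g p) = freeEnergy n (s * β) 0 g := by
  unfold freeEnergy
  congr 1
  refine Finset.sum_congr rfl fun σ _ => ?_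
  rw [mul_hamiltonian_zero_field, mul_hamiltonian_zero_field]
  congr 1
  exact Finset.sum_congr rfl fun p _ => by ring

theorem measurable_freeEnergy (β : ℝ) : Measurable (freeEnergy n β 0) := by
  unfold freeEnergy hamiltonian
  fun_prop

end SKModel

/-! ### Fluctuations of the free energy -/

/-- If a transformation `T` of the probability space changes probabilities by at most `d`, while it
increases `X` by more than `c` on an event of probability at least `p`, then `X` cannot be
concentrated on an interval of length `c`. -/
theorem measureReal_mem_Icc_le_of_shift {α : Type*} [MeasurableSpace α] {P : Measure α}
    [IsProbabilityMeasure P] {X : α → ℝ} {T : α → α} {G : Set α} {c d p : ℝ} (hX : Measurable X)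
    (hT : Measurable T) (hTV : ∀ A, MeasurableSet A → P.real A ≤ P.real {x | T x ∈ A} + d)
    (hG : MeasurableSet G) (hp : p ≤ P.real G) (hshift : ∀ x ∈ G, c < X (T x) - X x)
    {a b : ℝ} (hab : b - a ≤ c) :
    P.real {x | a ≤ X x ∧ X x ≤ b} ≤ 1 - (p - d) / 2 := by
  -- where `T` shifts `X` by more than `c`, the points `x` and `T x` cannot both lie in `I`
  set I : Set α := {x | a ≤ X x ∧ X x ≤ b}
  have hI : MeasurableSet I :=
    (measurableSet_le measurable_const hX).inter (measurableSet_le hX measurable_const)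
  have hJ : MeasurableSet {x | T x ∈ I} := hT hI
  have h1 := measureReal_union_add_inter (μ := P) (s := I) hJ
  have h2 : P.real (I ∩ {x | T x ∈ I}) ≤ P.real Gᶜ := by
    refine measureReal_mono fun x hx hxG => ?_
    have := hshift x hxG
    have := hx.1.1
    have := hx.2.2
    linarith
  have h3 := probReal_compl_eq_one_sub (μ := P) hG
  have h4 : P.real (I ∪ {x | T x ∈ I}) ≤ 1 := measureReal_le_one
  have h5 := hTV I hI
  linarith

namespace SKModel

/-- On the event that the partition function at the inverse temperature `b ≤ β` is at least half
of its mean, dilating the couplings by `√(1 + ε / n)` increases the free energy at `β` by a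
constant. -/
theorem lt_freeEnergy_dilation_sub {n : ℕ} {b β ε : ℝ} (hb : 0 < b) (hbβ : b ≤ β) (hε : 0 < ε)
    (hεn : ε ≤ n) (hn : 2 * b ^ 2 + 8 ≤ n * b ^ 2) {g : SitePair n → ℝ}
    (hg : 2 ^ n * Real.exp (b ^ 2 * Fintype.card (SitePair n) / (2 * n)) / 2
      ≤ partitionFunction n b g) :
    ε * b ^ 2 / 48 < freeEnergy n β 0 (fun p => √(1 + ε / n) * g p) - freeEnergy n β 0 g := by
  have hn0 : (0 : ℝ) < n := hε.trans_le hεn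
  have hlow : n * b ^ 2 / 8 ≤ freeEnergy n b 0 g - n * Real.log 2 := by
    have h := Real.log_le_log (by positivity) hg
    rw [Real.log_div (by positivity) two_ne_zero, Real.log_mul (by positivity) (by positivity),
      Real.log_pow, Real.log_exp] at h
    have hN : b ^ 2 * Fintype.card (SitePair n) / (2 * n) = b ^ 2 * (n - 1) / 4 := by
      have := two_mul_card_sitePair (n := n)
      field_simp
      linear_combination 2 * this
    have hl : Real.log 2 < 1 := by linarith [Real.log_two_lt_d9]
    rw [hN] at h
    change _ ≤ freeEnergy n b 0 g at h
    linarith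
  have hβ : n * b ^ 2 / 8 ≤ freeEnergy n β 0 g - n * Real.log 2 := by
    have hr : 1 ≤ β / b := (one_le_div hb).2 hbβ
    have h := mul_freeEnergy_sub_le (b := b) hr g
    rw [div_mul_cancel₀ _ hb.ne'] at h
    refine hlow.trans (le_trans ?_ h)
    exact le_mul_of_one_le_left (le_trans (by positivity) hlow) hr
  have hu0 : 0 < ε / n := by positivity
  have hu1 : ε / n ≤ 1 := (div_le_one hn0).2 hεn
  have hs : 1 + ε / n / 3 ≤ √(1 + ε / n) := by
    apply Real.le_sqrt_of_sq_le
    nlinarith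
  have h := mul_freeEnergy_sub_le (b := β) (r := √(1 + ε / n)) (by linarith) g
  rw [freeEnergy_smul]
  have h1 : ε / n / 3 * (n * b ^ 2 / 8)
      ≤ (√(1 + ε / n) - 1) * (freeEnergy n β 0 g - n * Real.log 2) :=
    mul_le_mul (by linarith) hβ (by positivity) (by linarith)
  have h2 : ε / n / 3 * (n * b ^ 2 / 8) = ε * b ^ 2 / 24 := by
    field_simp
    norm_num
  have h3 : 0 < ε * b ^ 2 := by positivity
  linarith

/-- The bound for standard Gaussian couplings. For `ε = √(1 - b²) / 16`, the event in
`lt_freeEnergy_dilation_sub` has probability at least `4 ε`, and the dilation by `√(1 + ε / n)`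
costs at most `3 ε` in total variation, which leaves `(4 ε - 3 ε) / 2 = ε / 2`. -/
theorem couplingLaw_freeEnergy_mem_Icc_le {n : ℕ} {b β ε : ℝ} (hb : 0 < b) (hb1 : b < 1)
    (hbβ : b ≤ β) (hε : ε = √(1 - b ^ 2) / 16) (hn : 2 * b ^ 2 + 8 ≤ n * b ^ 2) {x y : ℝ}
    (hxy : y - x ≤ ε * b ^ 2 / 48) :
    (couplingLaw n).real {g | x ≤ freeEnergy n β 0 g ∧ freeEnergy n β 0 g ≤ y} ≤ 1 - ε / 2 := by
  have hb2 : b ^ 2 < 1 := by nlinarith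
  have hn0 : n ≠ 0 := by
    rintro rfl
    have := sq_nonneg b
    simp at hn
    linarith
  have hn1 : (1 : ℝ) ≤ n := by exact_mod_cast Nat.one_le_iff_ne_zero.2 hn0
  have hε0 : 0 < ε := by
    have : 0 < √(1 - b ^ 2) := Real.sqrt_pos.2 (by linarith)
    rw [hε]; positivity
  have hε1 : ε ≤ 1 / 16 := by
    have : √(1 - b ^ 2) ≤ 1 := Real.sqrt_le_one.2 (by nlinarith)
    rw [hε]; linarith
  have hu : ε / n ≤ ε := div_le_self hε0.le hn1
  have hu0 : 0 ≤ ε / n := by positivity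
  have hexp : Real.exp ((ε / n) ^ 2 * Fintype.card (SitePair n)) - 1 ≤ 2 * ε ^ 2 := by
    have hN : (ε / n) ^ 2 * Fintype.card (SitePair n) ≤ ε ^ 2 := by
      have : (Fintype.card (SitePair n) : ℝ) ≤ n ^ 2 := by
        have := two_mul_card_sitePair (n := n)
        nlinarith
      calc (ε / n) ^ 2 * Fintype.card (SitePair n) ≤ (ε / n) ^ 2 * n ^ 2 := by gcongr
        _ = ε ^ 2 := by field_simp
    have h1 : Real.exp (ε ^ 2) ≤ 1 + 2 * ε ^ 2 := by
      have h := Real.add_one_le_exp (-ε ^ 2)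
      have h2 : Real.exp (-ε ^ 2) * Real.exp (ε ^ 2) = 1 := by rw [← Real.exp_add]; simp
      have := Real.exp_pos (ε ^ 2)
      have hε2 : ε ^ 2 ≤ 1 / 2 := by nlinarith
      have h3 : (1 - ε ^ 2) * Real.exp (ε ^ 2) ≤ 1 := by
        rw [← h2]; gcongr; linarith
      have h4 : 1 ≤ (1 - ε ^ 2) * (1 + 2 * ε ^ 2) := by nlinarith [sq_nonneg ε]
      exact le_of_mul_le_mul_left (h3.trans h4) (by linarith)
    have := Real.exp_le_exp.2 hN
    linarith
  have hT : Measurable fun (g : SitePair n → ℝ) p => √(1 + ε / n) * g p := by fun_prop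
  have hkey := measureReal_mem_Icc_le_of_shift (P := couplingLaw n) (c := ε * b ^ 2 / 48)
    (p := 4 * ε) (d := 3 * ε) (measurable_freeEnergy β) hT (fun A hA => ?_)
    (measurableSet_le measurable_const (measurable_partitionFunction b))
    (le_trans (by rw [hε]; linarith) (le_measureReal_partitionFunction hn0 hb2))
    (fun g hg => lt_freeEnergy_dilation_sub hb hbβ hε0 (by linarith) hn hg) hxy
  · linarith
  · refine (measureReal_sub_dilation_le hu0 (by nlinarith) (t := 2 * ε) (by positivity) hA).trans ?_
    have : (Real.exp ((ε / n) ^ 2 * Fintype.card (SitePair n)) - 1) / (2 * (2 * ε)) ≤ ε := by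
      rw [div_le_iff₀ (by positivity)]
      nlinarith
    linarith

end SKModel

theorem mainTheorem4 {Ω : ℕ → Type*} [∀ n, MeasurableSpace (Ω n)]
    (μ : ∀ n, Measure (Ω n)) [∀ n, IsProbabilityMeasure (μ n)]
    (g : ∀ n, SKModel.SitePair n → Ω n → ℝ)
    (hlaw : ∀ n p, HasLaw (g n p) (gaussianReal 0 1) (μ n))
    (hindep : ∀ n, iIndepFun (g n) (μ n))
    (β : ℝ) (hβ : 0 < β) :
    HasFluctuationsOfOrderAtLeast μ
      (fun n ω => SKModel.freeEnergy n β 0 (fun p => g n p ω)) (fun _ => 1) := by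
  -- an inverse temperature at most `β` in the second-moment regime `b < 1`
  set b : ℝ := min β (1 / 2)
  have hb : 0 < b := lt_min hβ (by norm_num)
  have hb1 : b < 1 := (min_le_right _ _).trans_lt (by norm_num)
  have hsqrt : 0 < √(1 - b ^ 2) := Real.sqrt_pos.2 (by nlinarith)
  refine ⟨√(1 - b ^ 2) / 16 * b ^ 2 / 48, √(1 - b ^ 2) / 16 / 2, by positivity, by positivity, ?_⟩
  have hlarge : ∀ᶠ n : ℕ in atTop, 2 * b ^ 2 + 8 ≤ n * b ^ 2 :=
    (tendsto_natCast_atTop_atTop.atTop_mul_const (by positivity)).eventually_ge_atTop _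
  filter_upwards [hlarge] with n hn x y _ hxy
  rw [mul_one] at hxy
  have hm : ∀ p, AEMeasurable (g n p) (μ n) := fun p => (hlaw n p).aemeasurable
  have hmap : (μ n).map (fun ω p => g n p ω) = SKModel.couplingLaw n := by
    rw [(iIndepFun_iff_map_fun_eq_pi_map hm).1 (hindep n)]
    simp_rw [(hlaw n _).map_eq]
  have h := SKModel.couplingLaw_freeEnergy_mem_Icc_le hb hb1 (min_le_left β (1 / 2)) rfl hn hxy
  have hF := SKModel.measurable_freeEnergy (n := n) β
  have hI : MeasurableSet {a | x ≤ SKModel.freeEnergy n β 0 a ∧ SKModel.freeEnergy n β 0 a ≤ y} :=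
    (measurableSet_le measurable_const hF).inter (measurableSet_le hF measurable_const)
  rwa [← hmap, map_measureReal_apply_of_aemeasurable (aemeasurable_pi_lambda _ hm) hI] at h
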